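/- Let $G=(V,E)$ be a finite connected graph, loops and parallel edges allowed. Let $\mathbb E$ be its set of oriented edges: each edge gives two oriented edges $e,\bar e$ in opposite directions, with a tail and a head. Let $\mathcal H$ be the space of real flows, i.e. of functions $x:\mathbb E\to\mathbb R$ with $x_{\bar e}=-x_e$ for all $e\in\mathbb E$ and $\sum_{e:\,\mathrm{tail}(e)=v}x_e=0$ for all $v\in V$; let $\Lambda\subset\mathcal H$ be the lattice of integer-valued flows, and let $q(x)=\langle x,x\rangle$ with $\langle x,y\rangle=\frac12\sum_{e\in\mathbb E}x_ey_e$ (the inner product for which the edges, each with one chosen direction, are orthonormal). Let $$V_O=\{x\in\mathcal H \mid q(x)\le q(x-\mu)\text{ for all }\mu\in\Lambda\}$$ be the Voronoi cell of the origin, and let $\mathcal{FP}$ be the poset of its non-empty faces ($V_O$ itself included), ordered by inclusion. Subgraphs $H$ of $G$ are taken without isolated vertices, i.e. they are identified with sets of edges of $G$; the empty one is allowed. An orientation of $H$ chooses exactly one of $e,\bar e$ for each edge of $H$; it is strongly connected if any two vertices in the same connected component of $H$ are joined by oriented paths in both directions. Let $\mathcal{SC}$ be the set of all pairs $(H,D)$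 where $H$ is a subgraph of $G$ and $D$ is a strongly connected orientation of $H$, with $(H,D)\preceq(H',D')$ if and only if $H'\subseteq H$ and $D'$ is the orientation induced by $D$ on $H'$. Then there is an isomorphism of posets $\phi:\mathcal{FP}\to\mathcal{SC}$ such that, for every face $F$, with $\phi(F)=(H,D)$: 1. the codimension of $F$ in $\mathcal H$ equals the genus of $H$ (the sum of $|E(C)|-|V(C)|+1$ over the connected components $C$ of $H$); 2. $F$ is a vertex of $V_O$ (a single point) if and only if $H$ is $G$ minus its bridges. In particular $\phi$ restricts to a bijection between the vertices of $V_O$ and the strongly connected orientations of $G$ minus its bridges. -/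

import Mathlib

/-- A graph with vertex set `V`, possibly with loops and parallel edges, given by its set `𝔼` of
oriented edges: every edge is replaced by two oriented edges `e` and `rev e` in opposite
directions (`rev` is an involution without fixed points, also on the loops). -/
structure OGraph (V 𝔼 : Type*) where
  /-- the tail of an oriented edge -/
  tail : 𝔼 → V
  /-- the inverse of an oriented edge -/
  rev : 𝔼 → 𝔼
  rev_rev : ∀ e, rev (rev e) = e
  rev_ne : ∀ e, rev e ≠ e

namespace OGraph

section Combinatorics

variable {V 𝔼 : Type*} (G : OGraph V 𝔼)

/-- The head of an oriented edge. -/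
def head (e : 𝔼) : V := G.tail (G.rev e)

/-- There is an oriented edge from `u` to `v` in the set `S` of oriented edges. -/
def Step (S : Set 𝔼) (u v : V) : Prop := ∃ e ∈ S, G.tail e = u ∧ G.head e = v

/-- There is an oriented path from `u` to `v` all of whose edges belong to `S`.
If `S` is closed under `rev`, this says that `u` and `v` are in the same connected component of
the graph with edge set `S`. -/
def Reach (S : Set 𝔼) (u v : V) : Prop := Relation.ReflTransGen (G.Step S) u v

/-- The graph is connected (and has a vertex). -/
def Connected : Prop := Nonempty V ∧ ∀ u v : V, G.Reach Set.univ u v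

/-- An edge is a bridge if its ends are no longer connected once it is deleted. -/
def IsBridge (e : 𝔼) : Prop := ¬ G.Reach (Set.univ \ {e, G.rev e}) (G.tail e) (G.head e)

/-- The edges of the graph minus its bridges. -/
def nonBridges : Set 𝔼 := {e | ¬ G.IsBridge e}

/-- The number of (unoriented) edges of a set of oriented edges. -/
noncomputable def numEdges (S : Set 𝔼) : ℕ := ((fun e => s(e, G.rev e)) '' S).ncard

/-- The number of connected components of the spanning subgraph with edge set `S`. -/
noncomputable def numComponents (S : Set 𝔼) : ℕ := Nat.card (Quot (G.Step S))

/-- The genus (first Betti number) of the subgraph with edge set `S`, i.e. the sum of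
`#edges - #vertices + 1` over its connected components; isolated vertices contribute zero. -/
noncomputable def genus (S : Set 𝔼) : ℤ :=
  (G.numEdges S : ℤ) - (Nat.card V : ℤ) + (G.numComponents S : ℤ)

/-- A strongly connected orientation of a subgraph: a pair `(H, D)` where `H` is a subgraph
(without isolated vertices, hence given by its set of edges) and `D` is an orientation of the
edges of `H` which is strongly connected on each connected component of `H`. -/
@[ext]
structure SC where
  /-- the edges of the subgraph `H` (each with both of its directions) -/
  edges : Set 𝔼
  rev_mem : ∀ e ∈ edges, G.rev e ∈ edges
  /-- the oriented edges of the orientation `D` -/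
  orient : Set 𝔼
  orient_subset : orient ⊆ edges
  /-- each edge of `H` gets exactly one of its two directions -/
  orient_xor : ∀ e ∈ edges, Xor (e ∈ orient) (G.rev e ∈ orient)
  /-- vertices in the same component of `H` are joined by an oriented path of `D` -/
  strong : ∀ u v : V, G.Reach edges u v → G.Reach orient u v

/-- `(H, D) ≤ (H', D')` if and only if `H' ⊆ H` and `D'` is the orientation induced by `D`
on `H'`. -/
instance : PartialOrder G.SC where
  le a b := b.edges ⊆ a.edges ∧ b.orient = a.orient ∩ b.edges
  le_refl a := ⟨subset_rfl, (Set.inter_eq_left.2 a.orient_subset).symm⟩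
  le_trans a b c hab hbc := by
    refine ⟨hbc.1.trans hab.1, ?_⟩
    rw [hbc.2, hab.2, Set.inter_assoc, Set.inter_eq_right.2 hbc.1]
  le_antisymm a b hab hba := by
    have h : a.edges = b.edges := hba.1.antisymm hab.1
    refine SC.ext h ?_
    rw [hab.2, ← h, Set.inter_eq_left.2 a.orient_subset]

end Combinatorics

section Flows

variable {V 𝔼 : Type*} [DecidableEq V] [Fintype 𝔼] (G : OGraph V 𝔼)

/-- The module of `A`-valued flows: antisymmetric functions on the oriented edges such that the
values on the oriented edges emanating from any given vertex sum to zero. -/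
def flows (A : Type*) [CommRing A] : Submodule A (𝔼 → A) where
  carrier := {x | (∀ e, x (G.rev e) = - x e) ∧ ∀ v, ∑ e with G.tail e = v, x e = 0}
  zero_mem' := by simp
  add_mem' := by
    rintro x y ⟨hx, hx'⟩ ⟨hy, hy'⟩
    refine ⟨fun e => ?_, fun v => ?_⟩
    · simp only [Pi.add_apply, hx, hy]; ring
    · simp only [Pi.add_apply, Finset.sum_add_distrib, hx', hy', add_zero]
  smul_mem' := by
    rintro c x ⟨hx, hx'⟩
    refine ⟨fun e => ?_, fun v => ?_⟩
    · simp only [Pi.smul_apply, hx, smul_neg]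
    · simp only [Pi.smul_apply, ← Finset.smul_sum, hx', smul_zero]

/-- The lattice of integer flows inside the space of real flows. -/
def lattice : Set (G.flows ℝ) := {x | ∃ y ∈ G.flows ℤ, ∀ e, (x : 𝔼 → ℝ) e = (y e : ℝ)}

/-- The inner product for which the edges (each with one chosen direction) are orthonormal: every
edge occurs in the sum with both of its directions, which contribute equally. -/
noncomputable def innerProd (x y : G.flows ℝ) : ℝ :=
  (∑ e, (x : 𝔼 → ℝ) e * (y : 𝔼 → ℝ) e) / 2

/-- The quadratic form of the inner product. -/
noncomputable def q (x : G.flows ℝ) : ℝ := G.innerProd x x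

/-- The Voronoi cell of `p` with respect to the set `S` of points. -/
def voronoiCell (S : Set (G.flows ℝ)) (p : G.flows ℝ) : Set (G.flows ℝ) :=
  {x | ∀ m ∈ S, G.q (x - p) ≤ G.q (x - m)}

/-- The Voronoi cell of the origin for the lattice of integer flows. -/
def originCell : Set (G.flows ℝ) := G.voronoiCell G.lattice 0

/-- The poset of the non-empty faces of the Voronoi cell of the origin (the cell itself included),
ordered by inclusion. A face is the set of the points of the cell where some linear functional
attains its maximum over the cell. -/
abbrev FP : Type _ := {F : Set (G.flows ℝ) // F.Nonempty ∧ IsExposed ℝ G.originCell F}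

/-- The codimension, in the space of real flows, of the affine span of a set. -/
noncomputable def codim (F : Set (G.flows ℝ)) : ℕ :=
  Module.finrank ℝ (G.flows ℝ ⧸ (affineSpan ℝ F).direction)

end Flows

end OGraph

/-! Both posets are quotients of the space of flows. A flow `w` exposes the face `faceOf w` of the
cell, and its signs orient its support strongly (`signSC w`), because positive flow cannot leave a
set of vertices without returning. Conversely, a strongly connected orientation is a union of
oriented cycles, and the sum of these cycles is a flow with the given signs (`signSC_surjective`).

The geometric input is `originCell_eq_image_cube`: the Voronoi cell is the orthogonal projection of
a unit cube. Maximizing a flow `w` over the projection amounts to maximizing it over the cube, so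
`faceOf w` is the projection of the cube face whose coordinates on the support of `w` are fixed by
the signs of `w`. Hence inclusion of faces and the order on orientations are the same condition on
signs, and `exists_orderIso_of_surjective` gives the isomorphism. The orthogonal complement of the
direction of `faceOf w` consists of the flows supported where `w` is. Its dimension is the genus of
that support (`finrank_flowsOn`), and it is everything exactly when the support misses only bridges.
-/

namespace OGraph

/-! ### Oriented paths, trails and cycles. -/

section Cycles

variable {V 𝔼 : Type*} {G : OGraph V 𝔼}

theorem head_rev (e : 𝔼) : G.head (G.rev e) = G.tail e := by
  rw [head, G.rev_rev]

theorem tail_rev (e : 𝔼) : G.tail (G.rev e) = G.head e := rfl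

theorem rev_injective : Function.Injective G.rev :=
  Function.LeftInverse.injective G.rev_rev

theorem sum_rev [Fintype 𝔼] {M : Type*} [AddCommMonoid M] (G : OGraph V 𝔼) (f : 𝔼 → M) :
    ∑ e, f (G.rev e) = ∑ e, f e :=
  Equiv.sum_comp (Function.Involutive.toPerm G.rev G.rev_rev) f

theorem sum_mul_head [Fintype 𝔼] {x : 𝔼 → ℝ} (hx : ∀ e, x (G.rev e) = - x e) (f : V → ℝ) :
    ∑ e, x e * f (G.head e) = - ∑ e, x e * f (G.tail e) := by
  rw [← G.sum_rev, ← Finset.sum_neg_distrib]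
  exact Finset.sum_congr rfl fun e _ => by rw [hx, head_rev, neg_mul]

theorem Reach.mono {S S' : Set 𝔼} (h : S ⊆ S') {u v : V} (huv : G.Reach S u v) :
    G.Reach S' u v :=
  Relation.ReflTransGen.mono (fun _ _ ⟨e, he, h'⟩ => ⟨e, h he, h'⟩) _ _ huv

theorem Reach.symm {S : Set 𝔼} (hS : ∀ e ∈ S, G.rev e ∈ S) {u v : V} (h : G.Reach S u v) :
    G.Reach S v u := by
  induction h with
  | refl => exact .refl
  | tail _ hbc ih =>
    obtain ⟨e, he, rfl, rfl⟩ := hbc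
    exact .head ⟨G.rev e, hS e he, G.tail_rev e, G.head_rev e⟩ ih

/-- A path to `v` can be stopped at its first visit to `v`. -/
theorem Reach.avoid_target {S : Set 𝔼} {u v : V} (h : G.Reach S u v) :
    G.Reach (S \ {e | G.tail e = v}) u v := by
  induction h using Relation.ReflTransGen.head_induction_on with
  | refl => exact .refl
  | @head a b hab _ ih =>
    obtain ⟨e, he, rfl, rfl⟩ := hab
    by_cases hv : G.tail e = v
    · rw [hv]; exact .refl
    · exact .head ⟨e, ⟨he, hv⟩, rfl, rfl⟩ ih

/-- A path from `u` can be started at its last visit to `u`. -/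
theorem Reach.exists_last_exit {S : Set 𝔼} {u v : V} (h : G.Reach S u v) :
    u = v ∨ ∃ e ∈ S, G.tail e = u ∧ G.Reach (S \ {e | G.tail e = u}) (G.head e) v := by
  induction h with
  | refl => exact .inl rfl
  | @tail b c _ hbc ih =>
    obtain ⟨f, hf, rfl, rfl⟩ := hbc
    right
    by_cases hu : G.tail f = u
    · exact ⟨f, hf, hu, .refl⟩
    · obtain h | ⟨e, he, heu, hr⟩ := ih
      · exact absurd h.symm hu
      · exact ⟨e, he, heu, .tail hr ⟨f, ⟨hf, hu⟩, rfl, rfl⟩⟩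

/-- A path can be replaced by a trail, given by its set of edges. -/
theorem Reach.exists_trail [DecidableEq V] [Finite 𝔼] {S : Set 𝔼} {u v : V}
    (h : G.Reach S u v) :
    ∃ T : Finset 𝔼, ↑T ⊆ S ∧ ∀ a, ∑ e ∈ T, ((if G.tail e = a then 1 else 0)
      - (if G.head e = a then 1 else 0) : ℤ)
      = (if u = a then 1 else 0) - (if v = a then 1 else 0) := by
  classical
  -- After the last exit from `u` no edge with tail `u` is used, so the allowed edge set shrinks and
  -- the exit edge is never repeated.
  induction S using WellFoundedLT.induction generalizing u with
  | ind S ih =>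
    obtain rfl | ⟨e, he, rfl, hr⟩ := h.exists_last_exit
    · exact ⟨∅, by simp, by simp⟩
    · obtain ⟨T, hT, hsum⟩ := ih (S \ {f | G.tail f = G.tail e})
        (Set.ssubset_iff_subset_ne.2 ⟨Set.sdiff_subset, fun h => by
          rw [← h] at he; exact he.2 rfl⟩) hr
      have heT : e ∉ T := fun h => (hT h).2 rfl
      refine ⟨insert e T, ?_, fun a => ?_⟩
      · rw [Finset.coe_insert, Set.insert_subset_iff]
        exact ⟨he, hT.trans Set.sdiff_subset⟩
      · rw [Finset.sum_insert heT, hsum]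
        ring

/-- An edge whose head reaches its tail lies on a cycle, given by its set of edges. -/
theorem Reach.exists_cycle [DecidableEq V] [Finite 𝔼] {S : Set 𝔼} {e : 𝔼} (he : e ∈ S)
    (h : G.Reach S (G.head e) (G.tail e)) :
    ∃ T : Finset 𝔼, ↑T ⊆ S ∧ e ∈ T ∧ ∀ a, ∑ f ∈ T, ((if G.tail f = a then 1 else 0)
      - (if G.head f = a then 1 else 0) : ℤ) = 0 := by
  classical
  obtain ⟨T, hT, hsum⟩ := h.avoid_target.exists_trail
  have heT : e ∉ T := fun h => (hT h).2 rfl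
  refine ⟨insert e T, ?_, Finset.mem_insert_self _ _, fun a => ?_⟩
  · rw [Finset.coe_insert, Set.insert_subset_iff]
    exact ⟨he, hT.trans Set.sdiff_subset⟩
  · rw [Finset.sum_insert heT, hsum]
    ring

end Cycles

/-! ### Sign patterns of flows and strongly connected orientations. -/

section Circulations

variable {V 𝔼 : Type*} [DecidableEq V] [Fintype 𝔼] {G : OGraph V 𝔼}

/-- The function on oriented edges which is `1` on `T` and `-1` on the reversed edges. -/
noncomputable def edgeChain (G : OGraph V 𝔼) (T : Finset 𝔼) (e : 𝔼) : ℤ :=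
  (T : Set 𝔼).indicator 1 e - (T : Set 𝔼).indicator 1 (G.rev e)

/-- Reindexing by `rev` turns the reversed indicator, summed over edges leaving `v`, into the number
of edges of `T` entering `v`. -/
theorem edgeChain_mem_flows {T : Finset 𝔼}
    (hT : ∀ a, ∑ f ∈ T, ((if G.tail f = a then 1 else 0)
      - (if G.head f = a then 1 else 0) : ℤ) = 0) : G.edgeChain T ∈ G.flows ℤ := by
  classical
  refine ⟨fun e => ?_, fun v => ?_⟩
  · simp only [edgeChain, G.rev_rev]; ring
  · rw [← hT v, Finset.sum_sub_distrib, Finset.sum_filter]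
    have hsub : ∀ e, (if G.tail e = v then G.edgeChain T e else 0)
        = (if G.tail e = v then (T : Set 𝔼).indicator 1 e else 0)
          - (if G.tail e = v then (T : Set 𝔼).indicator 1 (G.rev e) else 0) := fun e => by
      split_ifs <;> simp [edgeChain]
    rw [Finset.sum_congr rfl fun e _ => hsub e, Finset.sum_sub_distrib]
    congr 1
    · rw [← Finset.sum_subset (Finset.subset_univ T)]
      · exact Finset.sum_congr rfl fun e he => by simp [he]
      · intro e _ he; simp [he]
    · rw [← G.sum_rev, ← Finset.sum_subset (Finset.subset_univ T)]
      · exact Finset.sum_congr rfl fun e he => by simp [he, G.rev_rev, tail_rev]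
      · intro e _ he; simp [he, G.rev_rev]

theorem intCast_mem_flows {y : 𝔼 → ℤ} (hy : y ∈ G.flows ℤ) :
    (fun e => (y e : ℝ)) ∈ G.flows ℝ := by
  refine ⟨fun e => ?_, fun v => ?_⟩
  · simp only [hy.1 e, Int.cast_neg]
  · rw [← Int.cast_sum, hy.2 v, Int.cast_zero]

/-- Flows are orthogonal to potential differences. -/
theorem sum_mul_tail [Fintype V] {x : 𝔼 → ℝ} (hx : x ∈ G.flows ℝ) (f : V → ℝ) :
    ∑ e, x e * f (G.tail e) = 0 := by
  rw [← Finset.sum_fiberwise (s := Finset.univ) (g := G.tail)]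
  refine Finset.sum_eq_zero fun v _ => ?_
  rw [Finset.sum_congr rfl (g := fun e => x e * f v), ← Finset.sum_mul, hx.2 v, zero_mul]
  intro e he
  rw [(Finset.mem_filter.1 he).2]

/-- Every edge carrying a positive flow lies on a closed path of edges carrying a positive flow. -/
theorem reach_of_flow_pos [Fintype V] {x : 𝔼 → ℝ} (hx : x ∈ G.flows ℝ) {e : 𝔼} (he : 0 < x e) :
    G.Reach {f | 0 < x f} (G.head e) (G.tail e) := by
  classical
  -- Indicator of the vertices reachable from the head of `e`. Positive flow never leaves this set,
  -- so every term of the vanishing sum `h3` is nonnegative, hence zero; an unreachable tail would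
  -- give `e` a positive term.
  set R : V → ℝ := fun v => if G.Reach {f | 0 < x f} (G.head e) v then 1 else 0 with hR
  have h1 := sum_mul_tail hx R
  have h2 := sum_mul_head hx.1 R
  have h3 : ∑ f, x f * (R (G.head f) - R (G.tail f)) = 0 := by
    simp only [mul_sub, Finset.sum_sub_distrib, h1, h2, neg_zero, sub_zero]
  have hmono : ∀ f, 0 < x f → R (G.tail f) ≤ R (G.head f) := by
    intro f hf
    simp only [hR]
    split_ifs with ha hb
    · exact le_rfl
    · exact absurd (Relation.ReflTransGen.tail ha ⟨f, hf, rfl, rfl⟩) hb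
    · exact zero_le_one
    · exact le_rfl
  have h4 : ∀ f ∈ Finset.univ, 0 ≤ x f * (R (G.head f) - R (G.tail f)) := by
    intro f _
    rcases lt_trichotomy (x f) 0 with h | h | h
    · have := hmono (G.rev f) (by rw [hx.1]; linarith)
      rw [head_rev, tail_rev] at this
      exact mul_nonneg_of_nonpos_of_nonpos h.le (by linarith)
    · simp [h]
    · exact mul_nonneg h.le (sub_nonneg.2 (hmono f h))
  have h5 := (Finset.sum_eq_zero_iff_of_nonneg h4).1 h3 e (Finset.mem_univ _)
  by_contra hn
  have h6 : R (G.head e) = 1 := if_pos .refl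
  have h7 : R (G.tail e) = 0 := if_neg hn
  rw [h6, h7] at h5
  linarith

/-- The strongly connected orientation of the support of a flow given by its signs. -/
def signSC [Fintype V] (G : OGraph V 𝔼) (w : G.flows ℝ) : G.SC where
  edges := {e | w.1 e ≠ 0}
  rev_mem e he := by
    change w.1 (G.rev e) ≠ 0
    rw [w.2.1]; exact neg_ne_zero.2 he
  orient := {e | 0 < w.1 e}
  orient_subset e he := ne_of_gt (show 0 < w.1 e from he)
  orient_xor e he := by
    have he : w.1 e ≠ 0 := he
    simp only [Set.mem_ofPred_eq, w.2.1, Xor]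
    rcases lt_or_gt_of_ne he with h | h
    · right; constructor <;> linarith
    · left; constructor <;> linarith
  strong u v h := by
    induction h with
    | refl => exact .refl
    | tail _ hbc ih =>
      obtain ⟨e, he, rfl, rfl⟩ := hbc
      have he : w.1 e ≠ 0 := he
      rcases lt_or_gt_of_ne he with h | h
      · have := reach_of_flow_pos w.2 (e := G.rev e) (by rw [w.2.1]; linarith)
        rw [head_rev, tail_rev] at this
        exact ih.trans this
      · exact ih.tail ⟨e, h, rfl, rfl⟩

/-- By antisymmetry the set where a flow is positive determines where it is negative, hence also its
support. -/
theorem signSC_le_signSC_iff [Fintype V] {w w' : G.flows ℝ} :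
    G.signSC w ≤ G.signSC w' ↔ ∀ e, 0 < w'.1 e → 0 < w.1 e := by
  constructor
  · intro h e he
    have : e ∈ (G.signSC w').orient := he
    rw [h.2] at this
    exact this.1
  · intro h
    have hneg : ∀ e, w'.1 e < 0 → w.1 e < 0 := fun e he => by
      have := h (G.rev e) (by rw [w'.2.1]; linarith)
      rw [w.2.1] at this
      linarith
    refine ⟨fun e he => ?_, ?_⟩
    · rcases lt_or_gt_of_ne (show w'.1 e ≠ 0 from he) with h' | h'
      · exact (hneg e h').ne
      · exact (h e h').ne'
    · ext e
      refine ⟨fun he => ⟨h e he, ne_of_gt (show 0 < w'.1 e from he)⟩, fun ⟨he, he'⟩ => ?_⟩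
      have he : 0 < w.1 e := he
      rcases lt_or_gt_of_ne (show w'.1 e ≠ 0 from he') with h' | h'
      · exact absurd (hneg e h') (by linarith)
      · exact h'

/-- Every strongly connected orientation is given by the signs of a flow. -/
theorem signSC_surjective [Fintype V] : Function.Surjective (G.signSC) := by
  classical
  intro D
  have key : ∀ e ∈ D.orient, ∃ T : Finset 𝔼, ↑T ⊆ D.orient ∧ e ∈ T ∧ G.edgeChain T ∈ G.flows ℤ := by
    intro e he
    obtain ⟨T, h1, h2, h3⟩ := Reach.exists_cycle he (D.strong _ _
      (.single ⟨G.rev e, D.rev_mem e (D.orient_subset he), G.tail_rev e, G.head_rev e⟩))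
    exact ⟨T, h1, h2, edgeChain_mem_flows h3⟩
  choose! T hTD heT hT using key
  -- One cycle of `D` through each edge of `D`. All of them agree in sign with `D`, so nothing
  -- cancels in the sum.
  let w : G.flows ℝ := ∑ e with e ∈ D.orient, if h : e ∈ D.orient then
    ⟨_, intCast_mem_flows (hT e h)⟩ else 0
  have hw : ∀ f, w.1 f = ∑ e with e ∈ D.orient, (G.edgeChain (T e) f : ℝ) := by
    intro f
    simp only [w, Submodule.coe_sum, Finset.sum_apply]
    refine Finset.sum_congr rfl fun e he => ?_
    rw [dif_pos (Finset.mem_filter.1 he).2]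
  have hpos : ∀ f ∈ D.orient, 0 < w.1 f := by
    intro f hf
    have hrev : G.rev f ∉ D.orient := by
      rcases D.orient_xor f (D.orient_subset hf) with h | h
      · exact h.2
      · exact absurd hf h.2
    have hval : ∀ e ∈ D.orient, G.edgeChain (T e) f = ((T e : Set 𝔼).indicator 1 f : ℤ) := by
      intro e he
      rw [edgeChain, Set.indicator_of_notMem (fun h => hrev (hTD e he h)), sub_zero]
    rw [hw]
    refine Finset.sum_pos' (fun e he => ?_) ⟨f, by simpa using hf, ?_⟩
    · rw [hval e (Finset.mem_filter.1 he).2]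
      exact_mod_cast Set.indicator_nonneg (fun _ _ => zero_le_one) f
    · rw [hval f hf, Set.indicator_of_mem (by exact_mod_cast heT f hf)]
      simp
  have hneg : ∀ f, G.rev f ∈ D.orient → w.1 f < 0 := fun f hf => by
    have := hpos _ hf
    rw [w.2.1] at this
    linarith
  have hzero : ∀ f, f ∉ D.edges → w.1 f = 0 := by
    intro f hf
    have hrev : G.rev f ∉ D.edges := fun h => hf (by simpa [G.rev_rev] using D.rev_mem _ h)
    rw [hw]
    refine Finset.sum_eq_zero fun e he => ?_
    have he := (Finset.mem_filter.1 he).2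
    rw [edgeChain, Set.indicator_of_notMem (fun h => hf (D.orient_subset (hTD e he h))),
      Set.indicator_of_notMem (fun h => hrev (D.orient_subset (hTD e he h)))]
    simp
  refine ⟨w, SC.ext ?_ ?_⟩
  · ext f
    refine ⟨fun h => by_contra fun h' => h (hzero f h'), fun h => ?_⟩
    rcases D.orient_xor f h with h | h
    · exact (hpos f h.1).ne'
    · exact (hneg f h.1).ne
  · ext f
    refine ⟨fun h => ?_, hpos f⟩
    have h : 0 < w.1 f := h
    by_contra h'
    by_cases hf : f ∈ D.edges
    · rcases D.orient_xor f hf with h1 | h1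
      · exact h' h1.1
      · linarith [hneg f h1.1]
    · linarith [hzero f hf]

/-- The bridges are the edges on which all flows vanish. -/
theorem mem_nonBridges_iff [Fintype V] {e : 𝔼} :
    e ∈ G.nonBridges ↔ ∃ w : G.flows ℝ, w.1 e ≠ 0 := by
  have hclosed : ∀ f ∈ Set.univ \ {e, G.rev e}, G.rev f ∈ Set.univ \ {e, G.rev e} := by
    rintro f ⟨-, hf⟩
    refine ⟨trivial, fun h => hf ?_⟩
    rcases h with h | h
    · right; rw [Set.mem_singleton_iff, ← h, G.rev_rev]
    · left; exact rev_injective h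
  simp only [nonBridges, IsBridge, not_not, Set.mem_ofPred_eq]
  constructor
  · intro h
    -- Allowing `e` but not its reverse keeps the chain of the cycle from cancelling at `e`.
    obtain ⟨T, hT, heT, hsum⟩ := Reach.exists_cycle (S := {G.rev e}ᶜ) (G.rev_ne e).symm
      (Reach.mono (fun f hf hf' => hf.2 (.inr hf')) (h.symm hclosed))
    refine ⟨⟨_, intCast_mem_flows (edgeChain_mem_flows hsum)⟩, ?_⟩
    have hrev : G.rev e ∉ (T : Set 𝔼) := fun h => hT h rfl
    have heT : e ∈ (T : Set 𝔼) := heT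
    simp [edgeChain, Set.indicator_of_notMem hrev, Set.indicator_of_mem heT]
  · rintro ⟨w, hw⟩
    wlog hpos : 0 < w.1 e generalizing w
    · refine this (-w) (by simpa using hw) ?_
      have := lt_of_le_of_ne (not_lt.1 hpos) hw
      simpa using this
    refine Reach.symm hclosed (Reach.mono ?_ (reach_of_flow_pos w.2 hpos).avoid_target)
    rintro f ⟨hf, hf'⟩
    refine ⟨trivial, ?_⟩
    rintro (rfl | rfl)
    · exact hf' rfl
    · have hf : 0 < w.1 (G.rev e) := hf
      rw [w.2.1] at hf
      linarith

end Circulations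

/-! ### Orthogonal projection for the dot product. -/

section DotForm

open Matrix

variable {ι : Type*} [Fintype ι]

/-- The restriction of the dot product to a subspace. -/
def dotForm (U : Submodule ℝ (ι → ℝ)) : LinearMap.BilinForm ℝ U :=
  LinearMap.BilinForm.restrict (dotProductBilin ℝ ℝ) U

variable {U : Submodule ℝ (ι → ℝ)}

theorem dotForm_apply (x y : U) : dotForm U x y = x.1 ⬝ᵥ y.1 := rfl

theorem dotForm_isRefl : (dotForm U).IsRefl := fun x y h => by
  rw [dotForm_apply, dotProduct_comm] at h; exact h

theorem dotForm_nondegenerate : (dotForm U).Nondegenerate := by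
  refine dotForm_isRefl.nondegenerate_iff_separatingLeft.2 fun x hx => ?_
  exact Subtype.ext (dotProduct_self_eq_zero.1 (hx x))

/-- The orthogonal projection to a subspace. -/
noncomputable def dotProj (U : Submodule ℝ (ι → ℝ)) : (ι → ℝ) →ₗ[ℝ] U :=
  ((dotForm U).toDual dotForm_nondegenerate).symm.toLinearMap ∘ₗ
    (dotProductBilin ℝ ℝ).compl₁₂ LinearMap.id U.subtype

/-- Turns linear optimization over a projected set into optimization over the set itself. -/
theorem dotProj_dotProduct (c : ι → ℝ) (y : U) : (dotProj U c).1 ⬝ᵥ y.1 = c ⬝ᵥ y.1 :=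
  LinearMap.BilinForm.apply_toDual_symm_apply (hB := dotForm_nondegenerate)
    (((dotProductBilin ℝ ℝ).compl₁₂ LinearMap.id U.subtype) c) y

theorem exists_dotProduct_eq (l : U →ₗ[ℝ] ℝ) : ∃ w : U, ∀ x : U, l x = w.1 ⬝ᵥ x.1 :=
  ⟨((dotForm U).toDual dotForm_nondegenerate).symm l, fun x =>
    (LinearMap.BilinForm.apply_toDual_symm_apply (hB := dotForm_nondegenerate) l x).symm⟩

end DotForm

/-! ### The dimension of the space of flows supported on a subgraph. -/

section Genus

open Matrix Module

variable {V 𝔼 : Type*} (G : OGraph V 𝔼)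

/-- The antisymmetric functions supported on `S`. -/
def antisymmOn (S : Set 𝔼) : Submodule ℝ (𝔼 → ℝ) where
  carrier := {x | (∀ e, x (G.rev e) = - x e) ∧ ∀ e ∉ S, x e = 0}
  zero_mem' := by simp
  add_mem' := by
    rintro x y ⟨hx, hx'⟩ ⟨hy, hy'⟩
    refine ⟨fun e => ?_, fun e he => ?_⟩
    · simp only [Pi.add_apply, hx, hy]; ring
    · simp only [Pi.add_apply, hx' e he, hy' e he, add_zero]
  smul_mem' := by
    rintro c x ⟨hx, hx'⟩
    refine ⟨fun e => ?_, fun e he => ?_⟩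
    · simp only [Pi.smul_apply, hx, smul_neg]
    · simp only [Pi.smul_apply, hx' e he, smul_zero]

/-- One chosen direction `r p` per edge gives free coordinates. -/
theorem finrank_antisymmOn [Fintype 𝔼] {S : Set 𝔼} (hS : ∀ e ∈ S, G.rev e ∈ S) :
    finrank ℝ (G.antisymmOn S) = G.numEdges S := by
  classical
  have hr : ∀ p : ((fun e => s(e, G.rev e)) '' S : Set (Sym2 𝔼)),
      ∃ e ∈ S, s(e, G.rev e) = p.1 := fun p => p.2
  choose r hrS hr using hr
  have hinj : Function.Injective r := fun p p' h => Subtype.ext (by rw [← hr, ← hr, h])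
  have hne : ∀ p p', G.rev (r p) ≠ r p' := fun p p' h => by
    have : p = p' := Subtype.ext (by rw [← hr, ← hr, ← h, G.rev_rev, Sym2.eq_swap])
    exact G.rev_ne _ (this ▸ h)
  let L : G.antisymmOn S →ₗ[ℝ] (((fun e => s(e, G.rev e)) '' S : Set (Sym2 𝔼)) → ℝ) :=
    LinearMap.funLeft ℝ ℝ r ∘ₗ (G.antisymmOn S).subtype
  have hL : Function.Bijective L := by
    constructor
    · refine (injective_iff_map_eq_zero L).2 fun x hx => Subtype.ext (funext fun e => ?_)
      by_cases he : e ∈ S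
      · have h0 : x.1 (r ⟨_, e, he, rfl⟩) = 0 := congrFun hx ⟨_, e, he, rfl⟩
        rcases Sym2.eq_iff.1 (hr ⟨_, e, he, rfl⟩) with h | h
        · rwa [h.1] at h0
        · rw [h.1, x.2.1, neg_eq_zero] at h0
          exact h0
      · exact x.2.2 e he
    · intro y
      refine ⟨⟨fun e => ∑ p, y p * ((if r p = e then 1 else 0)
        - (if r p = G.rev e then 1 else 0)), fun e => ?_, fun e he => ?_⟩, funext fun p => ?_⟩
      · rw [← Finset.sum_neg_distrib]
        refine Finset.sum_congr rfl fun p _ => ?_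
        rw [G.rev_rev]; ring
      · refine Finset.sum_eq_zero fun p _ => ?_
        rw [if_neg, if_neg, sub_zero, mul_zero]
        · intro h
          have := hS _ (hrS p)
          rw [h, G.rev_rev] at this
          exact he this
        · rintro rfl; exact he (hrS p)
      · change ∑ p', y p' * ((if r p' = r p then 1 else 0)
          - (if r p' = G.rev (r p) then 1 else 0)) = y p
        rw [Finset.sum_eq_single p]
        · rw [if_pos rfl, if_neg (hne p p).symm, sub_zero, mul_one]
        · intro p' _ hp'
          rw [if_neg (hinj.ne hp'), if_neg (hne p p').symm, sub_zero, mul_zero]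
        · simp
  rw [(LinearEquiv.ofBijective L hL).finrank_eq, finrank_pi, ← Nat.card_eq_fintype_card]
  rfl

/-- The coboundary of a function on the vertices, restricted to the edges in `S`. -/
noncomputable def coboundary {S : Set 𝔼} (hS : ∀ e ∈ S, G.rev e ∈ S) :
    (V → ℝ) →ₗ[ℝ] G.antisymmOn S where
  toFun f := ⟨S.indicator fun e => f (G.tail e) - f (G.head e), fun e => by
    have hiff : G.rev e ∈ S ↔ e ∈ S := ⟨fun h => by simpa [G.rev_rev] using hS _ h, hS e⟩
    by_cases he : e ∈ S
    · rw [Set.indicator_of_mem he, Set.indicator_of_mem (hiff.2 he), head_rev, tail_rev, neg_sub]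
    · rw [Set.indicator_of_notMem he, Set.indicator_of_notMem (fun h => he (hiff.1 h)), neg_zero],
    fun e he => Set.indicator_of_notMem he _⟩
  map_add' f g := Subtype.ext <| funext fun e => by
    by_cases he : e ∈ S
    · simp [he]; ring
    · simp [he]
  map_smul' c f := Subtype.ext <| funext fun e => by
    by_cases he : e ∈ S
    · simp [he]; ring
    · simp [he]

theorem coboundary_apply {S : Set 𝔼} (hS : ∀ e ∈ S, G.rev e ∈ S) (f : V → ℝ) :
    (G.coboundary hS f).1 = S.indicator fun e => f (G.tail e) - f (G.head e) := rfl

theorem finrank_ker_coboundary [Fintype V] {S : Set 𝔼} (hS : ∀ e ∈ S, G.rev e ∈ S) :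
    finrank ℝ (LinearMap.ker (G.coboundary hS)) = G.numComponents S := by
  have : Finite (Quot (G.Step S)) := Finite.of_surjective _ Quot.mk_surjective
  have := Fintype.ofFinite (Quot (G.Step S))
  have hrange : LinearMap.ker (G.coboundary hS)
      = LinearMap.range (LinearMap.funLeft ℝ ℝ (Quot.mk (G.Step S))) := by
    ext f
    rw [LinearMap.mem_ker, LinearMap.mem_range]
    constructor
    · intro h
      refine ⟨Quot.lift f ?_, rfl⟩
      rintro u v ⟨e, he, rfl, rfl⟩
      have := congrFun (congrArg Subtype.val h) e
      rw [coboundary_apply, Set.indicator_of_mem he] at this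
      exact sub_eq_zero.1 this
    · rintro ⟨f, rfl⟩
      refine Subtype.ext (funext fun e => ?_)
      rw [coboundary_apply]
      by_cases he : e ∈ S
      · rw [Set.indicator_of_mem he]
        exact sub_eq_zero.2 (congrArg f (Quot.sound ⟨e, he, rfl, rfl⟩))
      · exact Set.indicator_of_notMem he _
  rw [hrange, LinearMap.finrank_range_of_inj
    (LinearMap.funLeft_injective_of_surjective ℝ ℝ _ Quot.mk_surjective), finrank_pi,
    ← Nat.card_eq_fintype_card]
  rfl

theorem coboundary_dotProduct [Fintype 𝔼] {S : Set 𝔼} (hS : ∀ e ∈ S, G.rev e ∈ S) (f : V → ℝ)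
    (x : G.antisymmOn S) :
    (G.coboundary hS f).1 ⬝ᵥ x.1 = 2 * ∑ e, x.1 e * f (G.tail e) := by
  have h := sum_mul_head (G := G) x.2.1 f
  have : ∀ e, (G.coboundary hS f).1 e * x.1 e
      = x.1 e * f (G.tail e) - x.1 e * f (G.head e) := by
    intro e
    rw [coboundary_apply]
    by_cases he : e ∈ S
    · rw [Set.indicator_of_mem he]; ring
    · rw [x.2.2 e he]; ring
  rw [dotProduct, Finset.sum_congr rfl fun e _ => this e, Finset.sum_sub_distrib, h]
  ring

variable [DecidableEq V] [Fintype 𝔼]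

/-- The real flows supported on `S`. -/
def flowsOn (S : Set 𝔼) : Submodule ℝ (G.flows ℝ) where
  carrier := {x | ∀ e ∉ S, x.1 e = 0}
  zero_mem' := by simp
  add_mem' := by
    intro x y hx hy e he
    rw [Submodule.coe_add, Pi.add_apply, hx e he, hy e he, add_zero]
  smul_mem' := by
    intro c x hx e he
    rw [Submodule.coe_smul, Pi.smul_apply, hx e he, smul_zero]

/-- Among antisymmetric functions on `S`, the flows are the orthogonal complement of the
coboundaries. The latter have dimension `#V` minus the number of components, by rank-nullity. -/
theorem finrank_flowsOn [Fintype V] {S : Set 𝔼} (hS : ∀ e ∈ S, G.rev e ∈ S) :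
    (finrank ℝ (G.flowsOn S) : ℤ) = G.genus S := by
  have hmap : (G.flowsOn S).map (G.flows ℝ).subtype
      = ((dotForm (G.antisymmOn S)).orthogonal (LinearMap.range (G.coboundary hS))).map
        (G.antisymmOn S).subtype := by
    ext x
    simp only [Submodule.mem_map, Submodule.subtype_apply]
    constructor
    · rintro ⟨x, hx, rfl⟩
      refine ⟨(⟨x.1, x.2.1, hx⟩ : G.antisymmOn S), ?_, rfl⟩
      rw [LinearMap.BilinForm.mem_orthogonal_iff]
      rintro _ ⟨f, rfl⟩
      rw [dotForm_apply, coboundary_dotProduct,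
        sum_mul_tail x.2, mul_zero]
    · rintro ⟨x, hx, rfl⟩
      rw [LinearMap.BilinForm.mem_orthogonal_iff] at hx
      refine ⟨⟨x.1, x.2.1, fun v => ?_⟩, x.2.2, rfl⟩
      -- The coboundary of the indicator of `v` tests conservation at `v`.
      have := hx _ ⟨fun u => if u = v then 1 else 0, rfl⟩
      rw [dotForm_apply, coboundary_dotProduct] at this
      simpa [Finset.sum_filter] using this
  have h1 := congrArg (fun U : Submodule ℝ (𝔼 → ℝ) => finrank ℝ U) hmap
  simp only [Submodule.finrank_map_subtype_eq] at h1
  have h2 := LinearMap.finrank_range_add_finrank_ker (G.coboundary hS)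
  rw [finrank_ker_coboundary, finrank_pi, ← Nat.card_eq_fintype_card] at h2
  have h3 := Submodule.finrank_le (LinearMap.range (G.coboundary hS))
  rw [LinearMap.BilinForm.finrank_orthogonal dotForm_nondegenerate] at h1
  rw [finrank_antisymmOn G hS] at h1 h3
  rw [genus]
  omega

end Genus

/-! ### The unit cube and its maximizers. -/

section Cube

variable {𝔼 : Type*}

/-- The cube of side one centered at the origin. -/
def cube (𝔼 : Type*) : Set (𝔼 → ℝ) := Set.Icc (fun _ => -(1 / 2)) (fun _ => 1 / 2)

theorem mem_cube_iff {c : 𝔼 → ℝ} : c ∈ cube 𝔼 ↔ ∀ e, |c e| ≤ 1 / 2 := by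
  simp only [cube, Set.mem_Icc, Pi.le_def, abs_le, forall_and]

theorem dotProduct_cube_le {c : 𝔼 → ℝ} (hc : c ∈ cube 𝔼) (w : 𝔼 → ℝ) (e : 𝔼) :
    c e * w e ≤ |w e| / 2 := by
  refine (le_abs_self _).trans ?_
  rw [abs_mul]
  have := mul_le_mul_of_nonneg_right (mem_cube_iff.1 hc e) (abs_nonneg (w e))
  linarith

/-- The vertex of the cube in the direction of `w`. -/
noncomputable def halfSign (w : 𝔼 → ℝ) (e : 𝔼) : ℝ := (SignType.sign (w e) : ℝ) / 2

theorem halfSign_mem_cube (w : 𝔼 → ℝ) : halfSign w ∈ cube 𝔼 := by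
  refine mem_cube_iff.2 fun e => ?_
  rcases lt_trichotomy (w e) 0 with h | h | h <;> simp [halfSign, h, abs_div]

theorem halfSign_mul (w : 𝔼 → ℝ) (e : 𝔼) : halfSign w e * w e = |w e| / 2 := by
  rw [halfSign, div_mul_eq_mul_div, sign_mul_self]

/-- Since the sign of `0` is `0`, `halfSign w` is centred in the coordinates where `w` vanishes, so
it records the signs of `w` exactly. -/
theorem halfSign_eq_half_iff {w : 𝔼 → ℝ} {e : 𝔼} : halfSign w e = 1 / 2 ↔ 0 < w e := by
  rcases lt_trichotomy (w e) 0 with h | h | h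
  · simp only [halfSign, sign_neg h, SignType.coe_neg_one]
    constructor <;> intro h' <;> linarith
  · simp [halfSign, h]
  · simp [halfSign, h]

end Cube

/-! ### The Voronoi cell as a zonotope, and its faces. -/

section Zonotope

open Matrix Module

variable {V 𝔼 : Type*} [DecidableEq V] [Fintype 𝔼] {G : OGraph V 𝔼}

theorem mem_originCell_iff {x : G.flows ℝ} :
    x ∈ G.originCell ↔ ∀ m ∈ G.lattice, 2 * (m.1 ⬝ᵥ x.1) ≤ m.1 ⬝ᵥ m.1 := by
  refine forall₂_congr fun m _ => ?_
  change ((x - 0).1 ⬝ᵥ (x - 0).1) / 2 ≤ ((x - m).1 ⬝ᵥ (x - m).1) / 2 ↔ _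
  rw [sub_zero, Submodule.coe_sub, sub_dotProduct, dotProduct_sub, dotProduct_sub,
    dotProduct_comm x.1 m.1]
  constructor <;> intro h <;> linarith

/-- Every nonzero flow conforms to a cycle. -/
theorem exists_conformal_cycle [Fintype V] {w : G.flows ℝ} (hw : w ≠ 0) :
    ∃ c : ℝ, ∃ y ∈ G.lattice, (∀ e, |(w - c • y).1 e| = |w.1 e| - c * |y.1 e|) ∧
      (∀ e, y.1 e * y.1 e = |y.1 e|) ∧ 0 < c ∧ ∃ e, w.1 e ≠ 0 ∧ (w - c • y).1 e = 0 := by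
  obtain ⟨e, he⟩ : ∃ e, 0 < w.1 e := by
    by_contra! h
    refine hw (Subtype.ext (funext fun e => le_antisymm (h e) ?_))
    have := h (G.rev e)
    rw [w.2.1] at this
    exact neg_nonpos.1 this
  obtain ⟨T, hT, heT, hsum⟩ := Reach.exists_cycle (S := {f | 0 < w.1 f}) he
    (reach_of_flow_pos w.2 he)
  -- Subtracting the least flow value on the cycle reverses no sign and empties `f`.
  obtain ⟨f, hf, hmin⟩ := Finset.exists_min_image T w.1 ⟨e, heT⟩
  have hpos : ∀ e ∈ T, 0 < w.1 e := fun e he => hT he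
  have hflow := edgeChain_mem_flows hsum
  let y : G.flows ℝ := ⟨_, intCast_mem_flows hflow⟩
  have hval : ∀ e, (e ∈ T ∧ y.1 e = 1) ∨ (G.rev e ∈ T ∧ y.1 e = -1) ∨ y.1 e = 0 := by
    intro e
    by_cases h1 : e ∈ T
    · have h2 : G.rev e ∉ T := fun h => by
        have h3 := hpos _ h1
        have h4 := hpos _ h
        rw [w.2.1] at h4
        linarith
      exact .inl ⟨h1, by simp [y, edgeChain, h1, h2]⟩
    · by_cases h2 : G.rev e ∈ T
      · exact .inr (.inl ⟨h2, by simp [y, edgeChain, h1, h2]⟩)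
      · exact .inr (.inr (by simp [y, edgeChain, h1, h2]))
  have hf0 := hpos f hf
  refine ⟨w.1 f, y, ⟨_, hflow, fun _ => rfl⟩, fun e => ?_, fun e => ?_, hf0, f, hf0.ne', ?_⟩
  · change |w.1 e - w.1 f * y.1 e| = _
    rcases hval e with ⟨h, hy⟩ | ⟨h, hy⟩ | hy
    · have := hmin e h
      rw [hy, abs_one, abs_of_nonneg (by linarith), abs_of_pos (hpos e h)]
    · have := hmin _ h
      rw [w.2.1] at this
      rw [hy, abs_neg, abs_one, abs_of_nonpos (by linarith), abs_of_neg (by linarith)]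
      ring
    · rw [hy]; simp
  · rcases hval e with ⟨h, hy⟩ | ⟨h, hy⟩ | hy <;> rw [hy] <;> simp
  · change w.1 f - w.1 f * y.1 f = 0
    rcases hval f with ⟨h, hy⟩ | ⟨h, hy⟩ | hy
    · rw [hy]; ring
    · have := hpos _ h
      rw [w.2.1] at this
      linarith
    · have : y.1 f = 1 := by
        rcases hval f with ⟨-, h⟩ | ⟨h, -⟩ | -
        · exact h
        · have := hpos _ h
          rw [w.2.1] at this
          linarith
        · have h2 : G.rev f ∉ T := fun h => by
            have h4 := hpos _ h
            rw [w.2.1] at h4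
            linarith
          simp [y, edgeChain, hf, h2]
      rw [this]; ring

/-- Bounds the support function of the cell by that of the projected cube. Conformal cycles are
peeled off `w`, so the absolute values add up. For a cycle `y` with entries `0, ±1` the bound is its
Voronoi inequality, as `y ⬝ᵥ y` is the sum of the `|y e|`. -/
theorem two_mul_dotProduct_le [Fintype V] {x : G.flows ℝ} (hx : x ∈ G.originCell)
    (w : G.flows ℝ) : 2 * (w.1 ⬝ᵥ x.1) ≤ ∑ e, |w.1 e| := by
  induction hn : {e | w.1 e ≠ 0}.ncard using Nat.strong_induction_on generalizing w with
  | _ n ih =>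
    subst hn
    by_cases hw : w = 0
    · simp [hw]
    obtain ⟨c, y, hy, habs, hsq, hc, e, he, he'⟩ := exists_conformal_cycle hw
    have h1 := ih _ (Set.ncard_lt_ncard ?_ (Set.toFinite _)) (w - c • y) rfl
    · have h2 := mem_originCell_iff.1 hx y hy
      have h3 : y.1 ⬝ᵥ y.1 = ∑ e, |y.1 e| := Finset.sum_congr rfl fun e _ => hsq e
      rw [h3] at h2
      rw [Finset.sum_congr rfl fun e _ => habs e, Finset.sum_sub_distrib, ← Finset.mul_sum,
        Submodule.coe_sub, Submodule.coe_smul, sub_dotProduct, smul_dotProduct, smul_eq_mul] at h1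
      have h4 := mul_le_mul_of_nonneg_left h2 hc.le
      linarith
    · refine Set.ssubset_iff_subset_ne.2 ⟨fun f hf hf' => hf ?_, fun h => ?_⟩
      · have h1 := habs f
        have h2 := abs_nonneg ((w - c • y).1 f)
        have h3 := mul_nonneg hc.le (abs_nonneg (y.1 f))
        rw [hf', abs_zero] at h1
        exact abs_eq_zero.1 (by linarith)
      · exact (h ▸ he : e ∈ {e | (w - c • y).1 e ≠ 0}) he'

/-- The Voronoi cell of the lattice of integer flows is a zonotope. -/
theorem originCell_eq_image_cube [Fintype V] :
    G.originCell = dotProj (G.flows ℝ) '' cube 𝔼 := by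
  ext x
  constructor
  · intro hx
    -- A point outside the projection would be separated from it by some `w`, whose value at the
    -- image of `halfSign w` already attains the bound of `two_mul_dotProduct_le`.
    by_contra hn
    have hcpt : IsCompact (dotProj (G.flows ℝ) '' cube 𝔼) :=
      isCompact_Icc.image (LinearMap.continuous_of_finiteDimensional _)
    obtain ⟨l, u, hl, hu⟩ := geometric_hahn_banach_closed_point
      ((convex_Icc _ _).linear_image (dotProj (G.flows ℝ))) hcpt.isClosed hn
    obtain ⟨w, hw⟩ := exists_dotProduct_eq l.toLinearMap
    have hw : ∀ x, l x = w.1 ⬝ᵥ x.1 := hw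
    have h1 := hl _ ⟨_, halfSign_mem_cube w.1, rfl⟩
    have h2 := two_mul_dotProduct_le hx w
    rw [hw] at hu
    rw [hw, dotProduct_comm, dotProj_dotProduct, dotProduct,
      Finset.sum_congr rfl fun e _ => halfSign_mul w.1 e, ← Finset.sum_div] at h1
    linarith
  · rintro ⟨c, hc, rfl⟩
    refine mem_originCell_iff.2 fun m ⟨y, _, hy⟩ => ?_
    rw [dotProduct_comm, dotProj_dotProduct, dotProduct, dotProduct, Finset.mul_sum]
    refine Finset.sum_le_sum fun e _ => ?_
    have h1 := dotProduct_cube_le hc m.1 e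
    -- This is where integrality of the lattice enters.
    have h2 : |m.1 e| ≤ m.1 e * m.1 e := by
      rw [hy, ← abs_mul_abs_self, ← Int.cast_abs]
      rcases (abs_nonneg (y e)).eq_or_lt with h | h
      · rw [← h]; simp
      · exact le_mul_of_one_le_left (by exact_mod_cast h.le) (by exact_mod_cast h)
    linarith

/-- The face of the Voronoi cell exposed by the inner product with `w`. -/
def faceOf (G : OGraph V 𝔼) (w : G.flows ℝ) : Set (G.flows ℝ) :=
  {x ∈ G.originCell | ∀ y ∈ G.originCell, w.1 ⬝ᵥ y.1 ≤ w.1 ⬝ᵥ x.1}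

/-- The functional is a sum of separately bounded coordinate terms, so it is maximal only if each
term is; coordinates where `w` vanishes remain free. -/
theorem dotProj_mem_faceOf_iff [Fintype V] {w : G.flows ℝ} {c : 𝔼 → ℝ} (hc : c ∈ cube 𝔼) :
    dotProj (G.flows ℝ) c ∈ G.faceOf w ↔ ∀ e, w.1 e ≠ 0 → c e = halfSign w.1 e := by
  have hle : ∀ e ∈ Finset.univ, c e * w.1 e ≤ halfSign w.1 e * w.1 e := fun e _ => by
    rw [halfSign_mul]; exact dotProduct_cube_le hc _ e
  have hiff : (∀ e, w.1 e ≠ 0 → c e = halfSign w.1 e) ↔ c ⬝ᵥ w.1 = halfSign w.1 ⬝ᵥ w.1 := by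
    rw [dotProduct, dotProduct, Finset.sum_eq_sum_iff_of_le hle]
    refine forall_congr' fun e => ?_
    simp only [Finset.mem_univ, true_imp_iff, mul_eq_mul_right_iff]
    tauto
  rw [hiff]
  constructor
  · rintro ⟨-, h⟩
    have := h _ (originCell_eq_image_cube.symm.subset ⟨_, halfSign_mem_cube w.1, rfl⟩)
    rw [dotProduct_comm, dotProj_dotProduct, dotProduct_comm w.1, dotProj_dotProduct] at this
    exact le_antisymm (Finset.sum_le_sum hle) this
  · intro h
    rw [faceOf, originCell_eq_image_cube]
    refine ⟨⟨c, hc, rfl⟩, ?_⟩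
    rintro _ ⟨d, hd, rfl⟩
    rw [dotProduct_comm, dotProj_dotProduct, dotProduct_comm w.1, dotProj_dotProduct, h]
    exact Finset.sum_le_sum fun e _ => by rw [halfSign_mul]; exact dotProduct_cube_le hd _ e

theorem halfSign_mem_faceOf [Fintype V] (w : G.flows ℝ) :
    dotProj (G.flows ℝ) (halfSign w.1) ∈ G.faceOf w :=
  (dotProj_mem_faceOf_iff (halfSign_mem_cube _)).2 fun _ _ => rfl

theorem exists_of_mem_faceOf [Fintype V] {w x : G.flows ℝ} (hx : x ∈ G.faceOf w) :
    ∃ c ∈ cube 𝔼, (∀ e, w.1 e ≠ 0 → c e = halfSign w.1 e) ∧ dotProj (G.flows ℝ) c = x := by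
  obtain ⟨c, hc, rfl⟩ := originCell_eq_image_cube.subset hx.1
  exact ⟨c, hc, (dotProj_mem_faceOf_iff hc).1 hx, rfl⟩

theorem halfSign_rev (w : G.flows ℝ) (e : 𝔼) : halfSign w.1 (G.rev e) = - halfSign w.1 e := by
  rw [halfSign, halfSign, w.2.1, Left.sign_neg, SignType.coe_neg, neg_div]

/-- The projection of `halfSign w` serves as a relative interior point of `faceOf w`: its membership
in `faceOf w'` already forces the sign condition. -/
theorem faceOf_subset_faceOf_iff [Fintype V] {w w' : G.flows ℝ} :
    G.faceOf w ⊆ G.faceOf w' ↔ ∀ e, 0 < w'.1 e → 0 < w.1 e := by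
  constructor
  · intro h e he
    have := (dotProj_mem_faceOf_iff (halfSign_mem_cube _)).1 (h (halfSign_mem_faceOf w)) e he.ne'
    rwa [halfSign_eq_half_iff.2 he, halfSign_eq_half_iff] at this
  · intro h x hx
    obtain ⟨c, hc, hcw, rfl⟩ := exists_of_mem_faceOf hx
    refine (dotProj_mem_faceOf_iff hc).2 fun e he => ?_
    rcases lt_or_gt_of_ne he with he | he
    · have h1 : 0 < w'.1 (G.rev e) := by rw [w'.2.1]; linarith
      have h2 := h _ h1
      have h3 : w.1 e ≠ 0 := by rw [w.2.1] at h2; linarith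
      rw [hcw e h3, ← neg_inj, ← halfSign_rev, ← halfSign_rev, halfSign_eq_half_iff.2 h1,
        halfSign_eq_half_iff.2 h2]
    · rw [hcw e (h e he).ne', halfSign_eq_half_iff.2 he, halfSign_eq_half_iff.2 (h e he)]

theorem vectorSpan_faceOf [Fintype V] (w : G.flows ℝ) :
    vectorSpan ℝ (G.faceOf w)
      = (Submodule.pi {e | w.1 e ≠ 0} fun _ => (⊥ : Submodule ℝ ℝ)).map
        (dotProj (G.flows ℝ)) := by
  refine le_antisymm (Submodule.span_le.2 ?_) ?_
  · rintro _ ⟨x, hx, y, hy, rfl⟩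
    obtain ⟨c, -, hc, rfl⟩ := exists_of_mem_faceOf hx
    obtain ⟨d, -, hd, rfl⟩ := exists_of_mem_faceOf hy
    refine ⟨c - d, fun e he => ?_, map_sub _ _ _⟩
    rw [Pi.sub_apply, hc e he, hd e he, sub_self]
    exact Submodule.zero_mem _
  · rintro _ ⟨a, ha, rfl⟩
    -- Scaling `a` by the inverse brings its entries within `1 / 2`; the `+ 1` covers `a = 0`.
    have hM : 0 < 2 * (‖a‖ + 1) := by positivity
    have hmem : halfSign w.1 + (2 * (‖a‖ + 1))⁻¹ • a ∈ cube 𝔼 := by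
      refine mem_cube_iff.2 fun e => ?_
      rw [Pi.add_apply, Pi.smul_apply, smul_eq_mul]
      by_cases he : w.1 e = 0
      · rw [halfSign, he, sign_zero, SignType.coe_zero, zero_div, zero_add, abs_mul,
          abs_of_pos (inv_pos.2 hM), inv_mul_le_iff₀ hM]
        have := norm_le_pi_norm a e
        rw [Real.norm_eq_abs] at this
        linarith
      · rw [show a e = 0 from ha e he, mul_zero, add_zero]
        exact mem_cube_iff.1 (halfSign_mem_cube w.1) e
    have h1 := vsub_mem_vectorSpan ℝ ((dotProj_mem_faceOf_iff (w := w) hmem).2 fun e he => by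
      rw [Pi.add_apply, Pi.smul_apply, show a e = 0 from ha e he, smul_zero, add_zero])
      (halfSign_mem_faceOf w)
    rw [vsub_eq_sub, ← map_sub, add_sub_cancel_left, map_smul] at h1
    exact (Submodule.smul_mem_iff _ (inv_pos.2 hM).ne').1 h1

/-- A flow pairs with a projected vector as with the vector itself, so unit vectors outside the
support of `w` force it to vanish there. -/
theorem orthogonal_vectorSpan_faceOf [Fintype V] (w : G.flows ℝ) :
    (dotForm (G.flows ℝ)).orthogonal (vectorSpan ℝ (G.faceOf w))
      = G.flowsOn {e | w.1 e ≠ 0} := by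
  classical
  ext y
  rw [vectorSpan_faceOf, LinearMap.BilinForm.mem_orthogonal_iff]
  constructor
  · intro h e he
    have := h _ ⟨Pi.single e 1, fun f hf => ?_, rfl⟩
    · rw [dotForm_apply, dotProj_dotProduct, single_dotProduct, one_mul] at this
      exact this
    · rw [Pi.single_eq_of_ne (by rintro rfl; exact he hf)]
      exact Submodule.zero_mem _
  · rintro h _ ⟨a, ha, rfl⟩
    rw [dotForm_apply, dotProj_dotProduct]
    refine Finset.sum_eq_zero fun e _ => ?_
    by_cases he : w.1 e = 0
    · rw [h e (fun h => h he), mul_zero]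
    · rw [show a e = 0 from ha e he, zero_mul]

theorem codim_faceOf [Fintype V] (w : G.flows ℝ) :
    G.codim (G.faceOf w) = finrank ℝ (G.flowsOn {e | w.1 e ≠ 0}) := by
  have h := Submodule.finrank_quotient_add_finrank (vectorSpan ℝ (G.faceOf w))
  rw [← orthogonal_vectorSpan_faceOf, LinearMap.BilinForm.finrank_orthogonal dotForm_nondegenerate,
    codim, direction_affineSpan]
  omega

/-- A face is a point when its direction is zero, that is, when every flow is supported where `w`
is. The edges carrying some flow are the non-bridges. -/
theorem exists_faceOf_eq_singleton_iff [Fintype V] (w : G.flows ℝ) :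
    (∃ v, G.faceOf w = {v}) ↔ {e | w.1 e ≠ 0} = G.nonBridges := by
  have h1 : (∃ v, G.faceOf w = {v}) ↔ vectorSpan ℝ (G.faceOf w) = ⊥ := by
    constructor
    · rintro ⟨v, hv⟩
      rw [hv, vectorSpan_singleton]
    · intro h
      refine ⟨_, Set.eq_singleton_iff_unique_mem.2 ⟨halfSign_mem_faceOf w, fun x hx => ?_⟩⟩
      have := vsub_mem_vectorSpan ℝ hx (halfSign_mem_faceOf w)
      rw [h] at this
      exact sub_eq_zero.1 this
  have h2 : vectorSpan ℝ (G.faceOf w) = ⊥ ↔ G.flowsOn {e | w.1 e ≠ 0} = ⊤ := by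
    rw [← orthogonal_vectorSpan_faceOf]
    constructor
    · intro h
      rw [h, LinearMap.BilinForm.orthogonal_bot]
    · intro h
      rw [← LinearMap.BilinForm.orthogonal_orthogonal dotForm_nondegenerate dotForm_isRefl
        (vectorSpan ℝ (G.faceOf w)), h, LinearMap.BilinForm.orthogonal_top_eq_bot
        dotForm_nondegenerate]
  rw [h1, h2]
  constructor
  · intro h
    refine Set.Subset.antisymm (fun e he => mem_nonBridges_iff.2 ⟨w, he⟩) fun e he => ?_
    obtain ⟨y, hy⟩ := mem_nonBridges_iff.1 he
    by_contra hn
    exact hy ((h ▸ Submodule.mem_top : y ∈ G.flowsOn {e | w.1 e ≠ 0}) e hn)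
  · intro h
    refine eq_top_iff.2 fun y _ e he => by_contra fun hy => he ?_
    rw [h]
    exact mem_nonBridges_iff.2 ⟨y, hy⟩

/-- The face exposed by the inner product with `w`, as an element of the poset of faces. -/
noncomputable def exposedFace [Fintype V] (G : OGraph V 𝔼) (w : G.flows ℝ) : G.FP :=
  ⟨G.faceOf w, ⟨_, halfSign_mem_faceOf w⟩,
    fun _ => ⟨LinearMap.toContinuousLinearMap (dotForm (G.flows ℝ) w), rfl⟩⟩

theorem exposedFace_surjective [Fintype V] : Function.Surjective G.exposedFace := by
  rintro ⟨F, hF, hexp⟩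
  obtain ⟨l, rfl⟩ := hexp hF
  obtain ⟨w, hw⟩ := exists_dotProduct_eq l.toLinearMap
  have hw : ∀ x, l x = w.1 ⬝ᵥ x.1 := hw
  refine ⟨w, Subtype.ext ?_⟩
  simp only [hw]
  rfl

end Zonotope

/-! ### Gluing the two parametrizations by flows. -/

/-- Two quotients of a set with the same induced preorder are isomorphic. -/
theorem exists_orderIso_of_surjective {α P Q : Type*} [PartialOrder P] [PartialOrder Q]
    {f : α → P} {g : α → Q} (hf : Function.Surjective f) (hg : Function.Surjective g)
    (h : ∀ a b, f a ≤ f b ↔ g a ≤ g b) : ∃ Φ : P ≃o Q, ∀ a, Φ (f a) = g a := by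
  -- The choice of preimage is harmless: points with equal `f` have equal `g` by antisymmetry.
  have hfg : ∀ a, g (Function.surjInv hf (f a)) = g a := fun a =>
    le_antisymm ((h _ _).1 (Function.surjInv_eq hf _).le) ((h _ _).1 (Function.surjInv_eq hf _).ge)
  refine ⟨RelIso.ofSurjective (OrderEmbedding.ofMapLEIff (fun p => g (Function.surjInv hf p))
    fun p p' => ?_) fun q => ?_, hfg⟩
  · rw [← h, Function.surjInv_eq hf, Function.surjInv_eq hf]
  · obtain ⟨a, rfl⟩ := hg q
    exact ⟨f a, hfg a⟩

end OGraph

theorem theorem1 {V 𝔼 : Type*} [Fintype V] [DecidableEq V] [Fintype 𝔼] (G : OGraph V 𝔼)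
    (hG : G.Connected) :
    ∃ Φ : G.FP ≃o G.SC,
      (∀ F : G.FP, (G.codim (F : Set (G.flows ℝ)) : ℤ) = G.genus (Φ F).edges) ∧
      (∀ F : G.FP, (∃ v : G.flows ℝ, (F : Set (G.flows ℝ)) = {v}) ↔
        (Φ F).edges = G.nonBridges) := by
  obtain ⟨Φ, hΦ⟩ := OGraph.exists_orderIso_of_surjective (G.exposedFace_surjective)
    (G.signSC_surjective) fun w w' =>
      (OGraph.faceOf_subset_faceOf_iff (w := w) (w' := w')).trans OGraph.signSC_le_signSC_iff.symm
  refine ⟨Φ, fun F => ?_, fun F => ?_⟩ <;> obtain ⟨w, rfl⟩ := OGraph.exposedFace_surjective F <;>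
    rw [hΦ]
  · exact (congrArg _ (OGraph.codim_faceOf w)).trans (G.finrank_flowsOn (G.signSC w).rev_mem)
  · exact OGraph.exists_faceOf_eq_singleton_iff w
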